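/- Let $\mathcal H$ be a complex Hilbert space and let $\mathcal B(\mathcal H)$ be the algebra of bounded linear operators on $\mathcal H$. For $T\in\mathcal B(\mathcal H)$ let $\|T\|$ be the operator norm, let $w(T)=\sup\{|\langle Tx,x\rangle| : x\in\mathcal H,\ \|x\|=1\}$ be the numerical radius, let $|T|=(T^*T)^{1/2}$, and for $s\ge 0$ let $|T|^s$ be defined by the continuous functional calculus, with $|T|^0=I$. Then for all $A,B,C,D\in\mathcal B(\mathcal H)$ and for both choices of the sign, $$ w(AB\pm CD)\le \frac14\Big(\inf_{t\in[0,1]}\big\||A|^{2t}+|B^*|^{2(1-t)}\big\|\,\big\||A^*|^{2(1-t)}+|B|^{2t}\big\| + \inf_{t\in[0,1]}\big\||C|^{2t}+|D^*|^{2(1-t)}\big\|\,\big\||C^*|^{2(1-t)}+|D|^{2t}\big\|\Big). $$ -/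

import Mathlib

noncomputable section

/-- The numerical radius `w(T) = sup {|⟨T x, x⟩| : ‖x‖ = 1}` of a bounded operator. -/
def numericalRadius {H : Type*} [NormedAddCommGroup H] [InnerProductSpace ℂ H]
    (T : H →L[ℂ] H) : ℝ :=
  sSup {r : ℝ | ∃ x : H, ‖x‖ = 1 ∧ r = ‖inner ℂ (T x) x‖}

/-- The power `|T|^s` of the modulus `|T| = (T* T)^{1/2}`, by continuous functional calculus;
`|T|^0` is the identity. -/
def absPow {H : Type*} [NormedAddCommGroup H] [InnerProductSpace ℂ H] [CompleteSpace H]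
    (T : H →L[ℂ] H) (s : ℝ) : H →L[ℂ] H :=
  CFC.abs T ^ s

/-- `inf_{0 ≤ t ≤ 1} ‖|S|^{2t} + |T*|^{2(1-t)}‖ ‖|S*|^{2(1-t)} + |T|^{2t}‖`. -/
def mixedInf {H : Type*} [NormedAddCommGroup H] [InnerProductSpace ℂ H] [CompleteSpace H]
    (S T : H →L[ℂ] H) : ℝ :=
  ⨅ t : Set.Icc (0 : ℝ) 1,
    ‖absPow S (2 * (t : ℝ)) + absPow (star T) (2 * (1 - (t : ℝ)))‖ *
      ‖absPow (star S) (2 * (1 - (t : ℝ))) + absPow T (2 * (t : ℝ))‖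

end

/-!
Write `R = |A*|^(1-t)`, `P = |A|^t`, `Q = |B*|^(1-t)`, `S = |B|^t`. Polar decomposition splits
`A = R K P` and `B = Q L S` with contractions `K`, `L`, so that
`⟨A B x, x⟩ = ⟨(K P Q L) S x, R x⟩` is at most `‖P Q‖ (‖R x‖² + ‖S x‖²) / 2`. The operator
arithmetic–geometric mean inequality `‖P Q‖ ≤ ‖P² + Q²‖ / 2` and
`‖R x‖² + ‖S x‖² ≤ ‖R² + S²‖ ‖x‖²` then bound `w(A B)`. A C⋆-algebra need not contain the polar
partial isometry of `a`, but the contractions `a (|a| + ε)⁻¹` do its work in the limit `ε → 0`.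
-/

open Set
open scoped ContinuousFunctionalCalculus InnerProduct

section Intertwining

variable {𝕜 A : Type*} {p : A → Prop} [RCLike 𝕜] [Ring A] [StarRing A] [Algebra 𝕜 A]
  [TopologicalSpace A] [ContinuousFunctionalCalculus 𝕜 A p] [IsSemitopologicalRing A] [T2Space A]
  {x a b : A}

theorem semiconjBy_cfcHom (ha : p a) (hb : p b) (h : SemiconjBy x a b)
    (h_star : SemiconjBy x (star a) (star b)) (f : C(↥(spectrum 𝕜 a ∪ spectrum 𝕜 b), 𝕜)) :
    SemiconjBy x (cfcHom ha (f.comp (.inclusion subset_union_left)))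
      (cfcHom hb (f.comp (.inclusion subset_union_right))) := by
  have : CompactSpace ↥(spectrum 𝕜 a ∪ spectrum 𝕜 b) := isCompact_iff_compactSpace.1 <|
    (isCompact_iff_compactSpace.2 inferInstance).union (isCompact_iff_compactSpace.2 inferInstance)
  induction f using ContinuousMap.induction_on_of_compact with
  | const r =>
    change SemiconjBy x (cfcHom ha (algebraMap 𝕜 _ r)) (cfcHom hb (algebraMap 𝕜 _ r))
    rw [AlgHomClass.commutes, AlgHomClass.commutes]
    exact (Algebra.commutes r x).symm
  | id =>
    change SemiconjBy x (cfcHom ha (.restrict _ (.id 𝕜))) (cfcHom hb (.restrict _ (.id 𝕜)))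
    rwa [cfcHom_id, cfcHom_id]
  | star_id =>
    change SemiconjBy x (cfcHom ha (star (.restrict _ (.id 𝕜))))
      (cfcHom hb (star (.restrict _ (.id 𝕜))))
    rwa [map_star, map_star, cfcHom_id, cfcHom_id]
  | add f g hf hg => simpa only [ContinuousMap.add_comp, map_add] using hf.add_right hg
  | mul f g hf hg => simpa only [ContinuousMap.mul_comp, map_mul] using hf.mul_right hg
  | frequently f hf =>
    have hcont {c : A} (hc : p c) (hsub : spectrum 𝕜 c ⊆ spectrum 𝕜 a ∪ spectrum 𝕜 b) :
        Continuous fun g : C(↥(spectrum 𝕜 a ∪ spectrum 𝕜 b), 𝕜) ↦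
          cfcHom hc (g.comp (.inclusion hsub)) :=
      (cfcHom_continuous hc).comp (ContinuousMap.continuous_precomp _)
    exact (isClosed_eq ((hcont ha subset_union_left).const_mul x)
      ((hcont hb subset_union_right).mul_const x)).mem_of_frequently_of_tendsto hf Filter.tendsto_id

theorem semiconjBy_cfc (ha : p a) (hb : p b) (h : SemiconjBy x a b)
    (h_star : SemiconjBy x (star a) (star b)) {f : 𝕜 → 𝕜}
    (hf : ContinuousOn f (spectrum 𝕜 a ∪ spectrum 𝕜 b)) :
    SemiconjBy x (cfc f a) (cfc f b) := by
  rw [cfc_apply f a ha (hf.mono subset_union_left), cfc_apply f b hb (hf.mono subset_union_right)]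
  exact semiconjBy_cfcHom ha hb h h_star ⟨_, hf.domRestrict⟩

end Intertwining

section Rpow

variable {A : Type*} [PartialOrder A] [Ring A] [StarRing A] [StarOrderedRing A] [Algebra ℝ A]
  [TopologicalSpace A] [ContinuousFunctionalCalculus ℝ A IsSelfAdjoint] [NonnegSpectrumClass ℝ A]

theorem rpow_add_of_nonneg (a : A) {s t : ℝ} (hs : 0 ≤ s) (ht : 0 ≤ t) :
    a ^ (s + t) = a ^ s * a ^ t := by
  rw [CFC.rpow_def, CFC.rpow_def, CFC.rpow_def, ← cfc_mul _ _ a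
    (NNReal.continuous_rpow_const hs).continuousOn (NNReal.continuous_rpow_const ht).continuousOn]
  exact cfc_congr fun r _ ↦ NNReal.rpow_add_of_nonneg r hs ht

variable [IsSemitopologicalRing A] [T2Space A]

theorem semiconjBy_rpow {x a b : A} (ha : 0 ≤ a) (hb : 0 ≤ b) (h : SemiconjBy x a b) {s : ℝ}
    (hs : 0 ≤ s) : SemiconjBy x (a ^ s) (b ^ s) := by
  rw [CFC.rpow_eq_cfc_real ha, CFC.rpow_eq_cfc_real hb]
  refine semiconjBy_cfc ha.isSelfAdjoint hb.isSelfAdjoint h ?_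
    (Real.continuous_rpow_const hs).continuousOn
  rwa [ha.isSelfAdjoint.star_eq, hb.isSelfAdjoint.star_eq]

theorem semiconjBy_cfcAbs_cfcAbs_star (a : A) : SemiconjBy a (CFC.abs a) (CFC.abs (star a)) := by
  have h : SemiconjBy a (star a * a) (star (star a) * star a) := by
    simp only [SemiconjBy, star_star, mul_assoc]
  rw [CFC.abs, CFC.abs, CFC.sqrt_eq_rpow, CFC.sqrt_eq_rpow]
  exact semiconjBy_rpow (star_mul_self_nonneg _) (star_mul_self_nonneg _) h (by norm_num)

end Rpow

section CStarAlgebra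

variable {A : Type*} [CStarAlgebra A]

theorem norm_star_mul_le_half_norm_add (a b : A) :
    ‖star a * b‖ ≤ ‖a * star a + b * star b‖ / 2 := by
  let := CStarAlgebra.spectralOrder A
  have := CStarAlgebra.spectralOrderedRing A
  set N := ‖a * star a + b * star b‖
  set c := star b * b with hc
  have hconj : star (star a * b) * (star a * b) + c * c ≤ N • c := by
    calc star (star a * b) * (star a * b) + c * c
        = star b * (a * star a + b * star b) * b := by
          simp only [hc, star_mul, star_star]; noncomm_ring
      _ ≤ N • c := CStarAlgebra.star_left_conjugate_le_norm_smul
  have hsquare : N • c - c * c ≤ algebraMap ℝ A ((N / 2) ^ 2) := by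
    have hself : IsSelfAdjoint (algebraMap ℝ A (N / 2) - c) :=
      (IsSelfAdjoint.algebraMap A (.all _)).sub (.star_mul_self b)
    have hexpand : algebraMap ℝ A ((N / 2) ^ 2) - (N • c - c * c) =
        (algebraMap ℝ A (N / 2) - c) * (algebraMap ℝ A (N / 2) - c) := by
      simp only [Algebra.algebraMap_eq_smul_one, mul_sub, sub_mul, smul_mul_assoc, mul_smul_comm,
        one_mul, mul_one]
      module
    exact sub_nonneg.1 (hexpand ▸ hself.mul_self_nonneg)
  have hle : ‖star (star a * b) * (star a * b)‖ ≤ (N / 2) ^ 2 :=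
    (CStarAlgebra.norm_le_iff_le_algebraMap _ (sq_nonneg _) (star_mul_self_nonneg _)).2 <|
      (le_sub_iff_add_le.2 hconj).trans hsquare
  rw [CStarRing.norm_star_mul_self, ← sq] at hle
  exact (sq_le_sq₀ (norm_nonneg _) (by positivity)).1 hle

variable [PartialOrder A] [StarOrderedRing A]

theorem norm_cfcAbs_mul (a x : A) : ‖CFC.abs a * x‖ = ‖a * x‖ := by
  have h : star (CFC.abs a * x) * (CFC.abs a * x) = star (a * x) * (a * x) := by
    calc star (CFC.abs a * x) * (CFC.abs a * x) = star x * (CFC.abs a * CFC.abs a) * x := by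
          rw [star_mul, (CFC.abs_nonneg a).isSelfAdjoint.star_eq]; noncomm_ring
      _ = star (a * x) * (a * x) := by
          rw [CFC.abs_mul_abs, star_mul]; noncomm_ring
  refine (mul_self_inj_of_nonneg (norm_nonneg _) (norm_nonneg _)).1 ?_
  rw [← CStarRing.norm_star_mul_self, ← CStarRing.norm_star_mul_self, h]

theorem exists_contraction_norm_mul_cfcAbs_sub_le (a : A) {ε : ℝ} (hε : 0 < ε) :
    ∃ k : A, ‖k‖ ≤ 1 ∧ SemiconjBy k (CFC.abs a) (CFC.abs (star a)) ∧ ‖k * CFC.abs a - a‖ ≤ ε := by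
  have habs : 0 ≤ CFC.abs a := CFC.abs_nonneg a
  have hpos {r : ℝ} (hr : r ∈ spectrum ℝ (CFC.abs a)) : 0 < r + ε :=
    add_pos_of_nonneg_of_pos (spectrum_nonneg_of_nonneg habs hr) hε
  have hcont : ContinuousOn (fun r : ℝ ↦ (r + ε)⁻¹) (spectrum ℝ (CFC.abs a)) :=
    (by fun_prop : ContinuousOn (fun r : ℝ ↦ r + ε) _).inv₀ fun r hr ↦ (hpos hr).ne'
  set g : A := cfc (fun r : ℝ ↦ (r + ε)⁻¹) (CFC.abs a)
  have hcomm : Commute g (CFC.abs a) := (Commute.refl _).cfc_real _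
  have habs_mul : CFC.abs a * g = cfc (fun r : ℝ ↦ r * (r + ε)⁻¹) (CFC.abs a) := by
    rw [cfc_mul (fun r : ℝ ↦ r) _ _ continuousOn_id hcont, cfc_id' ℝ (CFC.abs a)]
  have hresolvent : CFC.abs a * g + ε • g = 1 := by
    rw [habs_mul, ← cfc_smul ε _ _ hcont, ← cfc_add _ _ _ (by fun_prop) (by fun_prop),
      ← cfc_const_one ℝ (CFC.abs a)]
    refine cfc_congr fun r hr ↦ ?_
    simp only [smul_eq_mul, ← add_mul, mul_inv_cancel₀ (hpos hr).ne']
  have hnorm : ‖a * g‖ ≤ 1 := by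
    rw [← norm_cfcAbs_mul, habs_mul]
    refine norm_cfc_le zero_le_one fun r hr ↦ ?_
    have hr0 : 0 ≤ r := spectrum_nonneg_of_nonneg habs hr
    rw [Real.norm_of_nonneg (by positivity), ← div_eq_mul_inv, div_le_one (hpos hr)]
    exact le_add_of_nonneg_right hε.le
  refine ⟨a * g, hnorm, (semiconjBy_cfcAbs_cfcAbs_star a).mul_left hcomm, ?_⟩
  have herror : a * g * CFC.abs a - a = -(ε • (a * g)) := by
    calc a * g * CFC.abs a - a = a * (CFC.abs a * g) - a * (CFC.abs a * g + ε • g) := by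
          rw [mul_assoc, hcomm.eq, hresolvent, mul_one]
      _ = -(ε • (a * g)) := by rw [mul_add, mul_smul_comm]; abel
  rw [herror, norm_neg, norm_smul, Real.norm_of_nonneg hε.le]
  exact mul_le_of_le_one_right hε.le hnorm

theorem mem_closure_cfcAbs_star_rpow_mul_mul_cfcAbs_rpow (a : A) {t : ℝ} (ht : t ∈ Icc (0 : ℝ) 1) :
    a ∈ closure {b | ∃ k : A, ‖k‖ ≤ 1 ∧ CFC.abs (star a) ^ (1 - t) * k * CFC.abs a ^ t = b} := by
  refine (mem_closure_iff_nhds_basis Metric.nhds_basis_closedBall).2 fun ε hε ↦ ?_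
  obtain ⟨k, hk, hsemi, hclose⟩ := exists_contraction_norm_mul_cfcAbs_sub_le a hε
  have ht' : 0 ≤ 1 - t := sub_nonneg.2 ht.2
  have hfactor : CFC.abs (star a) ^ (1 - t) * k * CFC.abs a ^ t = k * CFC.abs a := by
    rw [← (semiconjBy_rpow (CFC.abs_nonneg a) (CFC.abs_nonneg _) hsemi ht').eq, mul_assoc,
      ← rpow_add_of_nonneg (CFC.abs a) ht' ht.1, sub_add_cancel,
      CFC.rpow_one _ (CFC.abs_nonneg a)]
  refine ⟨_, ⟨k, hk, rfl⟩, ?_⟩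
  rwa [hfactor, mem_closedBall_iff_norm]

end CStarAlgebra

section NumericalRadius

variable {H : Type*} [NormedAddCommGroup H] [InnerProductSpace ℂ H]

theorem norm_inner_le_numericalRadius (T : H →L[ℂ] H) {x : H} (hx : ‖x‖ = 1) :
    ‖inner ℂ (T x) x‖ ≤ numericalRadius T := by
  refine le_csSup ⟨‖T‖, ?_⟩ ⟨x, hx, rfl⟩
  rintro _ ⟨y, hy, rfl⟩
  calc ‖inner ℂ (T y) y‖ ≤ ‖T y‖ * ‖y‖ := norm_inner_le_norm _ _
    _ ≤ ‖T‖ := by simpa only [hy, mul_one] using T.le_opNorm y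

theorem numericalRadius_nonneg (T : H →L[ℂ] H) : 0 ≤ numericalRadius T :=
  Real.sSup_nonneg <| by rintro _ ⟨x, -, rfl⟩; exact norm_nonneg _

theorem numericalRadius_le_iff {T : H →L[ℂ] H} {c : ℝ} (hc : 0 ≤ c) :
    numericalRadius T ≤ c ↔ ∀ x, ‖x‖ = 1 → ‖inner ℂ (T x) x‖ ≤ c := by
  refine ⟨fun h x hx ↦ (norm_inner_le_numericalRadius T hx).trans h, fun h ↦ Real.sSup_le ?_ hc⟩
  rintro _ ⟨x, hx, rfl⟩
  exact h x hx

theorem isClosed_setOf_numericalRadius_le {c : ℝ} (hc : 0 ≤ c) :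
    IsClosed {T : H →L[ℂ] H | numericalRadius T ≤ c} := by
  simp only [numericalRadius_le_iff hc, ofPred_forall]
  exact isClosed_iInter fun x ↦ isClosed_iInter fun _ ↦ isClosed_le (by fun_prop) continuous_const

theorem numericalRadius_add_le (S T : H →L[ℂ] H) :
    numericalRadius (S + T) ≤ numericalRadius S + numericalRadius T := by
  refine (numericalRadius_le_iff
    (add_nonneg (numericalRadius_nonneg S) (numericalRadius_nonneg T))).2 fun x hx ↦ ?_
  rw [add_apply, inner_add_left]
  exact norm_add_le_of_le (norm_inner_le_numericalRadius S hx) (norm_inner_le_numericalRadius T hx)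

theorem numericalRadius_neg (T : H →L[ℂ] H) : numericalRadius (-T) = numericalRadius T := by
  simp only [numericalRadius, neg_apply, inner_neg_left, norm_neg]

theorem numericalRadius_sub_le (S T : H →L[ℂ] H) :
    numericalRadius (S - T) ≤ numericalRadius S + numericalRadius T := by
  simpa only [sub_eq_add_neg, numericalRadius_neg] using numericalRadius_add_le S (-T)

variable [CompleteSpace H]

theorem norm_sq_add_norm_sq_le {E F : Type*} [NormedAddCommGroup E] [InnerProductSpace ℂ E]
    [CompleteSpace E] [NormedAddCommGroup F] [InnerProductSpace ℂ F] [CompleteSpace F]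
    (R : H →L[ℂ] E) (S : H →L[ℂ] F) (x : H) :
    ‖R x‖ ^ 2 + ‖S x‖ ^ 2 ≤ ‖R† ∘L R + S† ∘L S‖ * ‖x‖ ^ 2 := by
  calc ‖R x‖ ^ 2 + ‖S x‖ ^ 2 = (inner ℂ ((R† ∘L R + S† ∘L S) x) x).re := by
        rw [R.apply_norm_sq_eq_inner_adjoint_left, S.apply_norm_sq_eq_inner_adjoint_left,
          add_apply, inner_add_left]
        rfl
    _ ≤ ‖(R† ∘L R + S† ∘L S) x‖ * ‖x‖ := re_inner_le_norm (𝕜 := ℂ) _ _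
    _ ≤ ‖R† ∘L R + S† ∘L S‖ * ‖x‖ * ‖x‖ := by gcongr; exact ContinuousLinearMap.le_opNorm _ _
    _ = ‖R† ∘L R + S† ∘L S‖ * ‖x‖ ^ 2 := by ring

theorem numericalRadius_adjoint_comp_comp_le {E F : Type*} [NormedAddCommGroup E]
    [InnerProductSpace ℂ E] [CompleteSpace E] [NormedAddCommGroup F] [InnerProductSpace ℂ F]
    [CompleteSpace F] (R : H →L[ℂ] E) (M : F →L[ℂ] E) (S : H →L[ℂ] F) :
    numericalRadius (R† ∘L M ∘L S) ≤ ‖M‖ * (‖R† ∘L R + S† ∘L S‖ / 2) := by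
  refine (numericalRadius_le_iff (by positivity)).2 fun x hx ↦ ?_
  have hRS : ‖R x‖ ^ 2 + ‖S x‖ ^ 2 ≤ ‖R† ∘L R + S† ∘L S‖ := by
    simpa only [hx, one_pow, mul_one] using norm_sq_add_norm_sq_le R S x
  calc ‖inner ℂ ((R† ∘L M ∘L S) x) x‖ = ‖inner ℂ (M (S x)) (R x)‖ :=
        congrArg _ (R.adjoint_inner_left x (M (S x)))
    _ ≤ ‖M (S x)‖ * ‖R x‖ := norm_inner_le_norm _ _
    _ ≤ ‖M‖ * ‖S x‖ * ‖R x‖ := by gcongr; exact M.le_opNorm _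
    _ = ‖M‖ * (‖R x‖ * ‖S x‖) := by ring
    _ ≤ ‖M‖ * (‖R† ∘L R + S† ∘L S‖ / 2) := by
        gcongr
        linarith [two_mul_le_add_sq ‖R x‖ ‖S x‖]

theorem isSelfAdjoint_absPow (T : H →L[ℂ] H) (s : ℝ) : IsSelfAdjoint (absPow T s) :=
  CFC.rpow_nonneg.isSelfAdjoint

theorem absPow_two_mul (T : H →L[ℂ] H) {s : ℝ} (hs : 0 ≤ s) :
    absPow T (2 * s) = absPow T s * absPow T s := by
  rw [two_mul]
  exact rpow_add_of_nonneg (CFC.abs T) hs hs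

theorem numericalRadius_mul_le (A B : H →L[ℂ] H) {t : ℝ} (ht : t ∈ Icc (0 : ℝ) 1) :
    numericalRadius (A * B) ≤ (1 / 4 : ℝ) *
      (‖absPow A (2 * t) + absPow (star B) (2 * (1 - t))‖ *
        ‖absPow (star A) (2 * (1 - t)) + absPow B (2 * t)‖) := by
  simp only [absPow_two_mul _ ht.1, absPow_two_mul _ (sub_nonneg.2 ht.2)]
  refine (isClosed_setOf_numericalRadius_le (by positivity)).closure_subset <|
    map_mem_closure₂ continuous_mul (mem_closure_cfcAbs_star_rpow_mul_mul_cfcAbs_rpow A ht)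
      (mem_closure_cfcAbs_star_rpow_mul_mul_cfcAbs_rpow B ht) ?_
  rintro _ ⟨K, hK, rfl⟩ _ ⟨L, hL, rfl⟩
  change numericalRadius ((absPow (star A) (1 - t) * K * absPow A t) *
    (absPow (star B) (1 - t) * L * absPow B t)) ≤ _
  have hP := (isSelfAdjoint_absPow A t).star_eq
  have hQ := (isSelfAdjoint_absPow (star B) (1 - t)).star_eq
  have hR := (isSelfAdjoint_absPow (star A) (1 - t)).star_eq
  have hS := (isSelfAdjoint_absPow B t).star_eq
  set P := absPow A t
  set Q := absPow (star B) (1 - t)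
  set R := absPow (star A) (1 - t)
  set S := absPow B t
  have hM : ‖K * (P * Q) * L‖ ≤ ‖P * P + Q * Q‖ / 2 := by
    calc ‖K * (P * Q) * L‖ ≤ ‖K‖ * ‖P * Q‖ * ‖L‖ := norm_mul₃_le
      _ ≤ 1 * ‖P * Q‖ * 1 := by gcongr
      _ = ‖P * Q‖ := by ring
      _ ≤ ‖P * P + Q * Q‖ / 2 := by simpa only [hP, hQ] using norm_star_mul_le_half_norm_add P Q
  calc numericalRadius ((R * K * P) * (Q * L * S))
      = numericalRadius (star R * (K * (P * Q) * L) * S) := by rw [hR]; simp only [mul_assoc]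
    _ ≤ ‖K * (P * Q) * L‖ * (‖star R * R + star S * S‖ / 2) :=
        numericalRadius_adjoint_comp_comp_le R (K * (P * Q) * L) S
    _ ≤ ‖P * P + Q * Q‖ / 2 * (‖R * R + S * S‖ / 2) := by rw [hR, hS]; gcongr
    _ = 1 / 4 * (‖P * P + Q * Q‖ * ‖R * R + S * S‖) := by ring

theorem numericalRadius_mul_le_mixedInf (A B : H →L[ℂ] H) :
    numericalRadius (A * B) ≤ (1 / 4 : ℝ) * mixedInf A B := by
  rw [mixedInf, Real.mul_iInf_of_nonneg (by norm_num)]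
  exact le_ciInf fun t ↦ numericalRadius_mul_le A B t.2

end NumericalRadius

theorem theorem2p15 {H : Type*} [NormedAddCommGroup H] [InnerProductSpace ℂ H] [CompleteSpace H]
    (A B C D : H →L[ℂ] H) :
    numericalRadius (A * B + C * D) ≤ (1 / 4 : ℝ) * (mixedInf A B + mixedInf C D) ∧
    numericalRadius (A * B - C * D) ≤ (1 / 4 : ℝ) * (mixedInf A B + mixedInf C D) := by
  have hbound : numericalRadius (A * B) + numericalRadius (C * D) ≤
      (1 / 4 : ℝ) * (mixedInf A B + mixedInf C D) := by
    rw [mul_add]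
    exact add_le_add (numericalRadius_mul_le_mixedInf A B) (numericalRadius_mul_le_mixedInf C D)
  exact ⟨(numericalRadius_add_le _ _).trans hbound, (numericalRadius_sub_le _ _).trans hbound⟩
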